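/- Let $a\ge 1$, $b\ge 0$ and $n\ge 0$ be integers. Let $V(\Pi^{a,b}_n)$ be the set of words of length $n$ that are concatenations of the blocks $0,1,\dots,a-1,\,0a,\,0(a+1),\dots,0(a+b-1)$ (that is, words over the alphabet $\{0,1,\dots,a+b-1\}$ in which each of the letters $a,\dots,a+b-1$ appears only immediately after a $0$). The Horadam cube $\Pi^{a,b}_n$ is the graph with vertex set $V(\Pi^{a,b}_n)$ in which two words are adjacent if and only if one is obtained from the other by replacing a single letter $k$ with $k+1$. Then: 1. $\Pi^{a,b}_n$ contains a Hamiltonian path (a path visiting each vertex exactly once). 2. If $n>2$ and $|V(\Pi^{a,b}_n)|$ is even, then $\Pi^{a,b}_n$ is Hamiltonian, that is, it contains a cycle visiting each vertex exactly once. 3. $|V(\Pi^{a,b}_n)|$ is even if and only if one of the following holds: $a$ and $b$ are even and $n\ge 1$; or $a$ is even, $b$ is odd and $n$ is odd; or $a$ and $b$ are odd and $n=3k-1$ for some integer $k\ge 1$. In particular, $\Pi^{a,b}_n$ is Hamiltonian if $a,b$ are even and $n\ge 3$; if $a$ is even, $b$ is odd and $n>1$ is odd; and if $a,b$ are odd and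 $n=3k-1$ with $k\ge 2$. -/

import Mathlib

/-- `IsHoradamString a b w`: the word `w` is a concatenation of primitive blocks, the primitive
blocks being the one-letter words `0, 1, …, a - 1` and the two-letter words `0 l` with
`a ≤ l ≤ a + b - 1`. -/
inductive IsHoradamString (a b : ℕ) : List ℕ → Prop
  | nil : IsHoradamString a b []
  | letter (x : ℕ) (w : List ℕ) (hx : x < a) (hw : IsHoradamString a b w) :
      IsHoradamString a b (x :: w)
  | block (l : ℕ) (w : List ℕ) (hal : a ≤ l) (hlb : l < a + b) (hw : IsHoradamString a b w) :
      IsHoradamString a b (0 :: l :: w)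

/-- The set of strings of length `n`: the vertices of the Horadam cube. -/
abbrev HoradamVertex (a b n : ℕ) : Type :=
  {w : List ℕ // IsHoradamString a b w ∧ w.length = n}

/-- `IsLetterIncrement v w`: the word `w` is obtained from `v` by replacing a single letter `k`
with `k + 1`. -/
def IsLetterIncrement (v w : List ℕ) : Prop :=
  ∃ (s t : List ℕ) (k : ℕ), v = s ++ k :: t ∧ w = s ++ (k + 1) :: t

theorem IsLetterIncrement.sum_eq {v w : List ℕ} (h : IsLetterIncrement v w) :
    w.sum = v.sum + 1 := by
  obtain ⟨s, t, k, rfl, rfl⟩ := h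
  simp only [List.sum_append, List.sum_cons]
  omega

/-- The Horadam cube: two strings of length `n` are adjacent if and only if one of them is obtained
from the other by replacing a single letter `k` with `k + 1`. -/
def horadamCube (a b n : ℕ) : SimpleGraph (HoradamVertex a b n) where
  Adj v w := IsLetterIncrement v.1 w.1 ∨ IsLetterIncrement w.1 v.1
  symm := ⟨fun _ _ h => h.symm⟩
  loopless := ⟨fun v h => by
    rcases h with h | h <;> (have := h.sum_eq; omega)⟩

theorem IsHoradamString.lt_of_mem {a b : ℕ} {w : List ℕ} (h : IsHoradamString a b w) :
    ∀ x ∈ w, x < a + b := by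
  induction h with
  | nil => simp
  | letter x w hx _ ih =>
    intro y hy
    rcases List.mem_cons.1 hy with rfl | hy
    · omega
    · exact ih y hy
  | block l w hal hlb _ ih =>
    intro y hy
    rcases List.mem_cons.1 hy with rfl | hy
    · omega
    rcases List.mem_cons.1 hy with rfl | hy
    · exact hlb
    · exact ih y hy

instance HoradamVertex.finite (a b n : ℕ) : Finite (HoradamVertex a b n) := by
  let f : HoradamVertex a b n → (Fin n → Fin (a + b)) := fun v i =>
    ⟨v.1[i.1]'(by rw [v.2.2]; exact i.2), v.2.1.lt_of_mem _ (List.getElem_mem _)⟩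
  refine Finite.of_injective f fun v w h => ?_
  apply Subtype.ext
  apply List.ext_getElem (v.2.2.trans w.2.2.symm)
  intro i hi hi'
  have := congrFun h ⟨i, by rw [← v.2.2]; exact hi⟩
  simpa [f] using this

/-! ### Hamiltonian walks from vertex lists -/

namespace SimpleGraph

variable {V : Type*} [DecidableEq V] {G : SimpleGraph V}

theorem exists_walk_isHamiltonian_of_list {l : List V} (hne : l ≠ []) (hc : l.IsChain G.Adj)
    (hnd : l.Nodup) (hmem : ∀ v, v ∈ l) :
    ∃ (u v : V) (p : G.Walk u v), p.IsHamiltonian := by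
  refine ⟨_, _, Walk.ofSupport l hne hc, ?_⟩
  refine Walk.IsPath.isHamiltonian_of_mem (Walk.IsPath.mk' ?_) ?_ <;>
  rwa [Walk.support_ofSupport]

theorem exists_walk_isHamiltonianCycle_of_list {l : List V} (hlen : 3 ≤ l.length)
    (hc : l.IsChain G.Adj) (hclose : ∀ x ∈ l.getLast?, ∀ y ∈ l.head?, G.Adj x y)
    (hnd : l.Nodup) (hmem : ∀ v, v ∈ l) :
    ∃ (v : V) (p : G.Walk v v), p.IsHamiltonianCycle := by
  have hne : l ≠ [] := by rintro rfl; simp at hlen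
  have hadj : G.Adj (l.getLast hne) (l.head hne) :=
    hclose _ (by simp [List.getLast?_eq_some_getLast hne]) _ (by simp [List.head?_eq_some_head hne])
  have hpath : (Walk.ofSupport l hne hc).IsPath :=
    Walk.IsPath.mk' (by rwa [Walk.support_ofSupport])
  have hham : (Walk.ofSupport l hne hc).IsHamiltonian :=
    hpath.isHamiltonian_of_mem (by rwa [Walk.support_ofSupport])
  refine ⟨_, Walk.cons hadj (Walk.ofSupport l hne hc), ?_⟩
  refine ⟨(Walk.cons_isCycle_iff _ _).2 ⟨hpath, fun he => ?_⟩, ?_⟩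
  -- A path containing the edge between its own ends has length one, hence only two vertices.
  · rw [Sym2.eq_swap] at he
    have := hpath.length_eq_one_of_mem_edges he
    rw [Walk.length_ofSupport] at this
    omega
  · intro x
    simpa using hham x

end SimpleGraph

/-! ### Boustrophedon lists -/

section Zigzag

variable {α β : Type*} {R : β → β → Prop}

/-- The rows `f x`, for `x` in a list, traversed alternately forwards and backwards; the first row
is traversed forwards if and only if the Boolean is `true`. -/
def zigzag (f : α → List β) : Bool → List α → List β
  | _, [] => []
  | true, x :: l => f x ++ zigzag f false l
  | false, x :: l => (f x).reverse ++ zigzag f true l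

theorem zigzag_perm_flatMap (f : α → List β) (d : Bool) (l : List α) :
    (zigzag f d l).Perm (l.flatMap f) := by
  induction l generalizing d with
  | nil => cases d <;> simp [zigzag]
  | cons x l ih =>
    cases d
    · simpa [zigzag] using (List.reverse_perm (f x)).append (ih true)
    · simpa [zigzag] using (ih false).append_left (f x)

theorem zigzag_concat (f : α → List β) (d : Bool) (l : List α) (x : α) :
    ∃ D, zigzag f d (l ++ [x]) = D ++ f x ∨ zigzag f d (l ++ [x]) = D ++ (f x).reverse := by
  induction l generalizing d with
  | nil => exact ⟨[], by cases d <;> simp [zigzag]⟩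
  | cons y l ih =>
    cases d
    · obtain ⟨D, h | h⟩ := ih true
      · exact ⟨(f y).reverse ++ D, by simp [zigzag, h]⟩
      · exact ⟨(f y).reverse ++ D, by simp [zigzag, h]⟩
    · obtain ⟨D, h | h⟩ := ih false
      · exact ⟨f y ++ D, by simp [zigzag, h]⟩
      · exact ⟨f y ++ D, by simp [zigzag, h]⟩

theorem head?_zigzag_cons {f : α → List β} {x : α} {l : List α} (hx : f x ≠ []) :
    (zigzag f true (x :: l)).head? = (f x).head? := by
  simp [zigzag, List.head?_append_of_ne_nil _ hx]

theorem head?_zigzag_false_cons {f : α → List β} {x : α} {l : List α} (hx : f x ≠ []) :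
    (zigzag f false (x :: l)).head? = (f x).getLast? := by
  simp [zigzag, List.head?_append_of_ne_nil _ (List.reverse_ne_nil_iff.2 hx)]

/-- Directions alternate from forwards, so the last of evenly many rows is read backwards. -/
theorem getLast?_zigzag_of_even {f : α → List β} (hf : ∀ x, f x ≠ []) {l : List α}
    (hl : Even l.length) :
    (zigzag f true l).getLast? = l.getLast?.bind fun x => (f x).head? := by
  induction l using List.twoStepInduction with
  | nil => simp [zigzag]
  | singleton x => simp at hl
  | cons_cons x y l ih _ =>
    rcases l with - | ⟨z, l⟩
    · obtain ⟨p, t, h⟩ := List.exists_cons_of_ne_nil (hf y)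
      simp [zigzag, List.getLast?_append, h]
    · have hne : zigzag f true (z :: l) ≠ [] := by simp [zigzag, hf]
      have h := ih (by simpa [Nat.even_add_one] using hl)
      rw [zigzag, zigzag, List.getLast?_append_of_ne_nil _ (by simp [hf]),
        List.getLast?_append_of_ne_nil _ hne, h, List.getLast?_cons_cons, List.getLast?_cons_cons]

/-- Turns alternate between the two sides; asking for adjacency on both sides avoids tracking the
direction. -/
theorem isChain_zigzag (hR : ∀ {x y}, R x y → R y x) {f : α → List β} (hf : ∀ x, f x ≠ [])
    {l : List α} (hc : ∀ x ∈ l, (f x).IsChain R)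
    (hl : l.IsChain fun x y => (∀ p ∈ (f x).head?, ∀ q ∈ (f y).head?, R p q) ∧
      ∀ p ∈ (f x).getLast?, ∀ q ∈ (f y).getLast?, R p q) (d : Bool) :
    (zigzag f d l).IsChain R := by
  have hrev : ∀ x ∈ l, (f x).reverse.IsChain R := fun x hx =>
    List.isChain_reverse.2 ((hc x hx).imp fun _ _ h => hR h)
  induction l generalizing d with
  | nil => cases d <;> simp [zigzag]
  | cons x l ih =>
    have ih' := ih (fun y hy => hc y (by simp [hy])) hl.tail
      (d := !d) (fun y hy => hrev y (by simp [hy]))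
    cases d
    · refine List.isChain_append.2 ⟨hrev x (by simp), ih', ?_⟩
      rcases l with - | ⟨y, l⟩
      · simp [zigzag]
      · rw [List.getLast?_reverse, head?_zigzag_cons (hf y)]
        exact (List.isChain_cons_cons.1 hl).1.1
    · refine List.isChain_append.2 ⟨hc x (by simp), ih', ?_⟩
      rcases l with - | ⟨y, l⟩
      · simp [zigzag]
      · rw [head?_zigzag_false_cons (hf y)]
        exact (List.isChain_cons_cons.1 hl).1.2

end Zigzag

/-! ### Cutting and gluing Horadam strings -/

theorem isHoradamString_cons_iff {a b x : ℕ} {w : List ℕ} :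
    IsHoradamString a b (x :: w) ↔ (x < a ∧ IsHoradamString a b w) ∨
      (x = 0 ∧ ∃ l w', w = l :: w' ∧ a ≤ l ∧ l < a + b ∧ IsHoradamString a b w') := by
  constructor
  · intro h
    cases h with
    | letter _ _ hx hw => exact Or.inl ⟨hx, hw⟩
    | block l w hal hlb hw => exact Or.inr ⟨rfl, l, w, rfl, hal, hlb, hw⟩
  · rintro (⟨hx, hw⟩ | ⟨rfl, l, w', rfl, hal, hlb, hw⟩)
    · exact .letter _ _ hx hw
    · exact .block _ _ hal hlb hw

theorem IsHoradamString.lt_of_cons {a b x : ℕ} {w : List ℕ} (ha : 1 ≤ a)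
    (h : IsHoradamString a b (x :: w)) : x < a := by
  rcases isHoradamString_cons_iff.1 h with h | h <;> omega

theorem IsHoradamString.append {a b : ℕ} {u v : List ℕ} (hu : IsHoradamString a b u)
    (hv : IsHoradamString a b v) : IsHoradamString a b (u ++ v) := by
  induction hu with
  | nil => exact hv
  | letter x w hx _ ih => exact .letter _ _ hx ih
  | block l w hal hlb _ ih => exact .block _ _ hal hlb ih

/-- Since `a ≥ 1`, a final `0` of `u` cannot be the second letter of a block; it is a block by
itself and can absorb `l`. -/
theorem IsHoradamString.append_cons {a b l : ℕ} {u v : List ℕ} (ha : 1 ≤ a)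
    (hu : IsHoradamString a b u) (h0 : u.getLast? = some 0) (hal : a ≤ l) (hlb : l < a + b)
    (hv : IsHoradamString a b v) : IsHoradamString a b (u ++ l :: v) := by
  induction hu with
  | nil => simp at h0
  | letter x w hx _ ih =>
    rcases w with - | ⟨y, w⟩
    · obtain rfl : x = 0 := by simpa using h0
      exact .block _ _ hal hlb hv
    · exact .letter _ _ hx (ih (by simpa using h0))
  | block m w ham hmb _ ih =>
    rcases w with - | ⟨y, w⟩
    · obtain rfl : m = 0 := by simpa using h0
      omega
    · exact .block _ _ ham hmb (ih (by simpa using h0))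

/-- A Horadam string can be cut at any place, unless the cut is in the middle of a block. -/
theorem IsHoradamString.exists_append {a b : ℕ} {w : List ℕ} (ha : 1 ≤ a)
    (hw : IsHoradamString a b w) {r : ℕ} (hr : r ≤ w.length) :
    ∃ u v, w = u ++ v ∧ u.length = r ∧ IsHoradamString a b u ∧
      (IsHoradamString a b v ∨ (u.getLast? = some 0 ∧ ∃ l v', v = l :: v' ∧ a ≤ l ∧ l < a + b ∧
        IsHoradamString a b v')) := by
  induction hw generalizing r with
  | nil => exact ⟨[], [], by simp_all [IsHoradamString.nil]⟩
  | letter x w hx hw ih =>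
    rcases r with - | r
    · exact ⟨[], _, rfl, rfl, .nil, .inl (.letter _ _ hx hw)⟩
    · obtain ⟨u, v, rfl, hlen, hu, hv⟩ := ih (r := r) (by simpa using hr)
      refine ⟨x :: u, v, rfl, by simp [hlen], .letter _ _ hx hu, hv.imp_right ?_⟩
      rintro ⟨h0, h⟩
      exact ⟨by simp [List.getLast?_cons, h0], h⟩
  | block l w hal hlb hw ih =>
    rcases r with - | - | r
    · exact ⟨[], _, rfl, rfl, .nil, .inl (.block _ _ hal hlb hw)⟩
    · exact ⟨[0], l :: w, rfl, rfl, .letter _ _ ha .nil,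
        .inr ⟨by simp, l, w, rfl, hal, hlb, hw⟩⟩
    · obtain ⟨u, v, rfl, hlen, hu, hv⟩ := ih (r := r) (by simpa using hr)
      refine ⟨0 :: l :: u, v, rfl, by simp [hlen], .block _ _ hal hlb hu, hv.imp_right ?_⟩
      rintro ⟨h0, h⟩
      exact ⟨by simp [List.getLast?_cons, h0], h⟩

/-! ### Enumerations along paths -/

/-- Two words are adjacent if one is obtained from the other by incrementing a letter. -/
def LetterAdj (v w : List ℕ) : Prop := IsLetterIncrement v w ∨ IsLetterIncrement w v

theorem LetterAdj.symm {v w : List ℕ} (h : LetterAdj v w) : LetterAdj w v := Or.symm h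

theorem letterAdj_cons_succ (k : ℕ) (t : List ℕ) : LetterAdj (k :: t) ((k + 1) :: t) :=
  .inl ⟨[], t, k, rfl, rfl⟩

theorem LetterAdj.append_left {v w : List ℕ} (u : List ℕ) (h : LetterAdj v w) :
    LetterAdj (u ++ v) (u ++ w) := by
  rcases h with ⟨s, t, k, rfl, rfl⟩ | ⟨s, t, k, rfl, rfl⟩
  · exact .inl ⟨u ++ s, t, k, by simp, by simp⟩
  · exact .inr ⟨u ++ s, t, k, by simp, by simp⟩

theorem LetterAdj.append_right {v w : List ℕ} (u : List ℕ) (h : LetterAdj v w) :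
    LetterAdj (v ++ u) (w ++ u) := by
  rcases h with ⟨s, t, k, rfl, rfl⟩ | ⟨s, t, k, rfl, rfl⟩
  · exact .inl ⟨s, t ++ u, k, by simp, by simp⟩
  · exact .inr ⟨s, t ++ u, k, by simp, by simp⟩

theorem LetterAdj.cons {v w : List ℕ} (x : ℕ) (h : LetterAdj v w) :
    LetterAdj (x :: v) (x :: w) := h.append_left [x]

/-- The list `L` enumerates the Horadam strings of length `n` along a Hamiltonian path. -/
structure IsHamiltonianList (a b n : ℕ) (L : List (List ℕ)) : Prop where
  isChain : L.IsChain LetterAdj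
  nodup : L.Nodup
  mem_iff : ∀ w, w ∈ L ↔ IsHoradamString a b w ∧ w.length = n

theorem IsHamiltonianList.reverse {a b n : ℕ} {L : List (List ℕ)} (h : IsHamiltonianList a b n L) :
    IsHamiltonianList a b n L.reverse where
  isChain := List.isChain_reverse.2 (h.isChain.imp fun _ _ => LetterAdj.symm)
  nodup := List.nodup_reverse.2 h.nodup
  mem_iff w := by rw [List.mem_reverse, h.mem_iff]

theorem exists_isHoradamString_length {a : ℕ} (b n : ℕ) (ha : 1 ≤ a) :
    ∃ w, IsHoradamString a b w ∧ w.length = n := by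
  induction n with
  | zero => exact ⟨[], .nil, rfl⟩
  | succ n ih =>
    obtain ⟨w, hw, hn⟩ := ih
    exact ⟨0 :: w, .letter _ _ ha hw, by simp [hn]⟩

theorem IsHamiltonianList.ne_nil {a b n : ℕ} {L : List (List ℕ)} (ha : 1 ≤ a)
    (h : IsHamiltonianList a b n L) : L ≠ [] := by
  obtain ⟨w, hw⟩ := exists_isHoradamString_length b n ha
  exact List.ne_nil_of_mem ((h.mem_iff w).2 hw)

theorem IsHamiltonianList.card_eq_length {a b n : ℕ} {L : List (List ℕ)}
    (h : IsHamiltonianList a b n L) : Nat.card (HoradamVertex a b n) = L.length := by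
  rw [← List.toFinset_card_of_nodup h.nodup, ← Fintype.card_coe, ← Nat.card_eq_fintype_card]
  exact Nat.card_congr (Equiv.subtypeEquivRight fun w => by simp [h.mem_iff])

/-! ### Count and parity -/

/-- Number of Horadam strings. -/
def horadamNumber (a b : ℕ) : ℕ → ℕ
  | 0 => 1
  | 1 => a
  | n + 2 => a * horadamNumber a b (n + 1) + b * horadamNumber a b n

/-- Modulo 2 the recursion has period 2 for `a` even and `b` odd, and is Fibonacci, of period 3, for
both odd. -/
theorem even_horadamNumber_iff (a b n : ℕ) : Even (horadamNumber a b n) ↔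
    (Even a ∧ Even b ∧ 1 ≤ n) ∨ (Even a ∧ Odd b ∧ Odd n) ∨
        (Odd a ∧ Odd b ∧ ∃ k : ℕ, 1 ≤ k ∧ n = 3 * k - 1) := by
  have key : ∀ n, (Even (horadamNumber a b n) ↔ (Even a ∧ Even b ∧ 1 ≤ n) ∨
      (Even a ∧ ¬ Even b ∧ n % 2 = 1) ∨ (¬ Even a ∧ ¬ Even b ∧ n % 3 = 2)) := by
    intro n
    induction n using Nat.twoStepInduction with
    | zero => simp [horadamNumber]
    | one => by_cases ha : Even a <;> by_cases hb : Even b <;> simp [horadamNumber, ha, hb]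
    | more n ih0 ih1 =>
      rw [horadamNumber, Nat.even_add, Nat.even_mul, Nat.even_mul, ih0, ih1]
      by_cases ha : Even a <;> by_cases hb : Even b <;> simp [ha, hb] <;> omega
  have hk : (∃ k : ℕ, 1 ≤ k ∧ n = 3 * k - 1) ↔ n % 3 = 2 :=
    ⟨by rintro ⟨k, hk, rfl⟩; omega, fun h => ⟨n / 3 + 1, by omega, by omega⟩⟩
  rw [key, hk, Nat.odd_iff (n := n)]
  simp only [Nat.not_even_iff_odd]

/-! ### The Hamiltonian path -/

theorem isChain_zigzag_map {α β γ : Type*} {R : γ → γ → Prop} {Q : β → β → Prop}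
    (hR : ∀ {x y}, R x y → R y x) {f : α → β → γ} {S : List β} (hS : S ≠ []) (hc : S.IsChain Q)
    {l : List α} (hf : ∀ x ∈ l, ∀ v w, Q v w → R (f x v) (f x w))
    (hl : l.IsChain fun x y => ∀ w, R (f x w) (f y w)) (d : Bool) :
    (zigzag (fun x => S.map (f x)) d l).IsChain R := by
  refine isChain_zigzag hR (fun _ => by simpa using hS) (fun x hx => ?_) (hl.imp fun x y h => ⟨?_, ?_⟩) d
  · exact List.isChain_map_of_isChain _ (hf x hx) hc
  · rw [List.head?_map, List.head?_map]
    rcases S.head? with - | w <;> simp [h]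
  · rw [List.getLast?_map, List.getLast?_map]
    rcases S.getLast? with - | w <;> simp [h]

theorem isChain_letterAdj_range' (s n : ℕ) :
    (List.range' s n).IsChain fun x y => ∀ w, LetterAdj (x :: w) (y :: w) :=
  (List.isChain_range' s n 1).imp fun x y (h : y = x + 1) w => h ▸ letterAdj_cons_succ x w

theorem IsHamiltonianList.exists_succ_succ {a b n : ℕ} {L K : List (List ℕ)} (ha : 1 ≤ a)
    (hL : IsHamiltonianList a b n L) (hK : IsHamiltonianList a b (n + 1) K)
    (hKL : ∀ w ∈ L.head?, K.head? = some ((a - 1) :: w)) :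
    ∃ D L', (L' = K ∨ L' = K.reverse) ∧
      IsHamiltonianList a b (n + 2) (D ++ L'.map (List.cons (a - 1))) ∧
      (D ++ L'.map (List.cons (a - 1))).length = a * K.length + b * L.length := by
  set T := zigzag (fun l => L.map fun w => 0 :: l :: w) true (List.range' a b) with hT
  set B := zigzag (fun x => K.map (List.cons x)) true (List.range' 0 a) with hB
  have hperm : (T.reverse ++ B).Perm ((List.range' a b).flatMap (fun l => L.map fun w => 0 :: l :: w)
      ++ (List.range' 0 a).flatMap fun x => K.map (List.cons x)) :=
    ((List.reverse_perm _).trans (zigzag_perm_flatMap _ _ _)).append (zigzag_perm_flatMap _ _ _)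
  have hM : IsHamiltonianList a b (n + 2) (T.reverse ++ B) := by
    refine ⟨?_, ?_, fun w => ?_⟩
    · have hTc : T.IsChain LetterAdj :=
        isChain_zigzag_map LetterAdj.symm (hL.ne_nil ha) hL.isChain
          (fun x _ v w h => (h.cons x).cons 0)
          ((isChain_letterAdj_range' a b).imp fun x y h w => (h w).cons 0) true
      have hBc : B.IsChain LetterAdj :=
        isChain_zigzag_map LetterAdj.symm (hK.ne_nil ha) hK.isChain
          (fun x _ v w h => h.cons x) (isChain_letterAdj_range' 0 a) true
      refine List.isChain_append.2 ⟨List.isChain_reverse.2 (hTc.imp fun _ _ => LetterAdj.symm),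
        hBc, ?_⟩
      obtain ⟨a, rfl⟩ : ∃ c, a = c + 1 := ⟨a - 1, by omega⟩
      rcases b with - | b
      · simp [hT, zigzag]
      -- The junction goes from `0 a v` to `0 (a-1) v`, with `v` the first word of `L`; this is
      -- where `hKL` enters.
      obtain ⟨v, t, rfl⟩ := List.exists_cons_of_ne_nil (hL.ne_nil ha)
      have hKh := hKL v rfl
      rw [hT, hB, List.getLast?_reverse, List.range'_succ, List.range'_succ,
        head?_zigzag_cons (by simp), head?_zigzag_cons (by simpa using hK.ne_nil ha)]
      simpa [hKh] using ((letterAdj_cons_succ a v).cons 0).symm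
    · rw [hperm.nodup_iff, List.nodup_append, List.nodup_flatMap, List.nodup_flatMap]
      refine ⟨⟨fun l _ => hL.nodup.map fun v w h => by simpa using h, ?_⟩,
        ⟨fun x _ => hK.nodup.map fun v w h => by simpa using h, ?_⟩, ?_⟩
      · refine (List.nodup_range' (s := a) (n := b)).imp fun {x y} h => ?_
        simp only [Function.onFun, List.disjoint_left, List.mem_map]
        grind
      · refine (List.nodup_range' (s := 0) (n := a)).imp fun {x y} h => ?_
        simp only [Function.onFun, List.disjoint_left, List.mem_map]
        grind
      -- The second letter separates the two families: at least `a` in a block, below `a` at the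
      -- start of a Horadam string.
      · simp only [List.mem_flatMap, List.mem_map, List.mem_range'_1]
        rintro _ ⟨l, hl, w, -, rfl⟩ _ ⟨x, hx, v, hv, rfl⟩ h
        simp only [List.cons.injEq] at h
        have := ((hK.mem_iff v).1 hv).1
        rw [← h.2] at this
        have := this.lt_of_cons ha
        omega
    · rw [hperm.mem_iff]
      simp only [List.mem_append, List.mem_flatMap, List.mem_map, List.mem_range'_1, hL.mem_iff,
        hK.mem_iff]
      constructor
      · rintro (⟨l, hl, w, ⟨hw, hn⟩, rfl⟩ | ⟨x, hx, w, ⟨hw, hn⟩, rfl⟩)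
        · exact ⟨.block _ _ hl.1 hl.2 hw, by simp [hn]⟩
        · exact ⟨.letter _ _ (by omega) hw, by simp [hn]⟩
      · rintro ⟨hw, hn⟩
        rcases w with - | ⟨x, w⟩
        · simp at hn
        rcases isHoradamString_cons_iff.1 hw with ⟨hx, hw⟩ | ⟨rfl, l, v, rfl, hal, hlb, hv⟩
        · exact .inr ⟨x, by omega, w, ⟨hw, by simpa using hn⟩, rfl⟩
        · exact .inl ⟨l, ⟨hal, hlb⟩, v, ⟨hv, by simpa using hn⟩, rfl⟩
  have hlen : (T.reverse ++ B).length = a * K.length + b * L.length := by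
    rw [hperm.length_eq]
    simp [List.length_flatMap, Nat.add_comm]
  obtain ⟨D, hD⟩ := zigzag_concat (fun x => K.map (List.cons x)) true (List.range' 0 (a - 1)) (a - 1)
  have hrange : List.range' 0 (a - 1) ++ [a - 1] = List.range' 0 a := by
    conv_rhs => rw [← Nat.sub_add_cancel ha, List.range'_concat]
    simp
  rw [hrange, ← hB] at hD
  rcases hD with hD | hD
  · rw [hD, ← List.append_assoc] at hM hlen
    exact ⟨_, K, .inl rfl, hM, hlen⟩
  · rw [hD, ← List.append_assoc, ← List.map_reverse] at hM hlen
    exact ⟨_, K.reverse, .inr rfl, hM, hlen⟩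

/-- The shape of the longer list is the induction invariant: reversing both lists moves the matching
ends to the front, as `exists_succ_succ` requires. -/
theorem exists_isHamiltonianList_pair {a : ℕ} (b n : ℕ) (ha : 1 ≤ a) :
    ∃ D L, IsHamiltonianList a b n L ∧
      IsHamiltonianList a b (n + 1) (D ++ L.map (List.cons (a - 1))) ∧
      L.length = horadamNumber a b n ∧
      (D ++ L.map (List.cons (a - 1))).length = horadamNumber a b (n + 1) := by
  induction n with
  | zero =>
    obtain ⟨a, rfl⟩ : ∃ c, a = c + 1 := ⟨a - 1, by omega⟩
    have hsplit : (List.range' 0 a).map (fun x => [x]) ++ [[]].map (List.cons (a + 1 - 1)) =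
        (List.range' 0 (a + 1)).map fun x => [x] := by
      rw [List.range'_concat]; simp
    refine ⟨(List.range' 0 a).map fun x => [x], [[]], ⟨by simp, by simp, fun w => ?_⟩, ?_,
      rfl, by simp [horadamNumber]⟩
    · simp only [List.mem_singleton, List.length_eq_zero_iff]
      exact ⟨fun h => ⟨h ▸ .nil, h⟩, And.right⟩
    · rw [hsplit]
      refine ⟨?_, (List.nodup_range' (s := 0) (n := a + 1)).map fun x y h => by simpa using h, fun w => ?_⟩
      · exact List.isChain_map_of_isChain _ (fun x y h => h []) (isChain_letterAdj_range' 0 _)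
      · simp only [List.mem_map, List.mem_range'_1, Nat.zero_add, List.length_eq_one_iff]
        constructor
        · rintro ⟨x, hx, rfl⟩
          exact ⟨.letter _ _ (by omega) .nil, x, rfl⟩
        · rintro ⟨hw, x, rfl⟩
          exact ⟨x, by have := hw.lt_of_cons ha; omega, rfl⟩
  | succ n ih =>
    obtain ⟨D, L, hL, hK, hlL, hlK⟩ := ih
    obtain ⟨D', L', hL', hM, hlen⟩ := hL.reverse.exists_succ_succ ha hK.reverse (by
      intro w hw
      rw [List.head?_reverse] at hw ⊢
      simp [List.getLast?_append, Option.mem_def.1 hw])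
    refine ⟨D', L', ?_, hM, ?_, ?_⟩
    · rcases hL' with rfl | rfl
      · exact hK.reverse
      · exact hK.reverse.reverse
    · rcases hL' with rfl | rfl <;> simpa [Nat.add_comm] using hlK
    · rw [hlen, List.length_reverse, List.length_reverse, hlK, hlL, horadamNumber]

/-! ### Rows of words with a common prefix -/

/-- The letters that follow the word `h`, starting from `a - 1` and continuing, if `h` ends with `0`,
with the second letters of the blocks of length two. -/
def horadamTail (a b : ℕ) (h : List ℕ) : List ℕ :=
  List.range' (a - 1) (if h.getLast? = some 0 then b + 1 else 1)

theorem mem_range'_extra_iff {a b l : ℕ} {h : List ℕ} :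
    l ∈ List.range' a (if h.getLast? = some 0 then b else 0) ↔
      h.getLast? = some 0 ∧ a ≤ l ∧ l < a + b := by
  split_ifs with h0 <;> simp [h0, List.mem_range'_1]

theorem horadamTail_eq_cons {a : ℕ} (b : ℕ) (h : List ℕ) (ha : 1 ≤ a) :
    horadamTail a b h = (a - 1) :: List.range' a (if h.getLast? = some 0 then b else 0) := by
  rw [horadamTail]
  split_ifs
  · rw [List.range'_succ, Nat.sub_add_cancel ha]
  · rfl

/-- The words that follow the prefix `h`: the list `D`, and then the strings of `L` preceded by the
letters of `horadamTail a b h`. -/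
def horadamRow (a b : ℕ) (D L : List (List ℕ)) (h : List ℕ) : List (List ℕ) :=
  D ++ zigzag (fun w => (horadamTail a b h).map fun l => l :: w) true L

section Row

variable {a b m : ℕ} {D L : List (List ℕ)}

theorem head?_horadamRow (ha : 1 ≤ a) (hne : L ≠ []) (h : List ℕ) :
    (horadamRow a b D L h).head? = (D ++ L.map (List.cons (a - 1))).head? := by
  obtain ⟨w, t, rfl⟩ := List.exists_cons_of_ne_nil hne
  rw [horadamRow, List.head?_append, List.head?_append, head?_zigzag_cons] <;>
  simp [horadamTail_eq_cons b h ha]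

/-- The last of evenly many columns is read down to the letter `a - 1`, so the end does not depend
on `h`. -/
theorem getLast?_horadamRow (ha : 1 ≤ a) (heven : Even L.length) (h : List ℕ) :
    (horadamRow a b D L h).getLast? = (D ++ L.map (List.cons (a - 1))).getLast? := by
  rw [horadamRow, List.getLast?_append, List.getLast?_append, getLast?_zigzag_of_even _ heven,
    List.getLast?_map]
  · cases L.getLast? <;> simp [horadamTail_eq_cons b h ha]
  · simp [horadamTail_eq_cons b h ha]

theorem isChain_horadamRow (ha : 1 ≤ a) (hne : L ≠ []) (hL : L.IsChain LetterAdj)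
    (hDL : (D ++ L.map (List.cons (a - 1))).IsChain LetterAdj) (h : List ℕ) :
    (horadamRow a b D L h).IsChain LetterAdj := by
  obtain ⟨hD, -, hjoin⟩ := List.isChain_append.1 hDL
  refine List.isChain_append.2 ⟨hD, ?_, ?_⟩
  · exact isChain_zigzag_map (Q := fun l k => ∀ w, LetterAdj (l :: w) (k :: w))
      (S := horadamTail a b h) LetterAdj.symm (by simp [horadamTail_eq_cons b h ha]) (isChain_letterAdj_range' _ _)
      (fun w _ l k hlk => hlk w) (hL.imp fun v w h l => h.cons l) true
  · have := head?_horadamRow (b := b) (D := []) ha hne h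
    rw [horadamRow, List.nil_append, List.nil_append] at this
    rwa [this]

theorem horadamRow_perm (ha : 1 ≤ a) (h : List ℕ) :
    (horadamRow a b D L h).Perm (D ++ L.map (List.cons (a - 1)) ++ L.flatMap fun w =>
      (List.range' a (if h.getLast? = some 0 then b else 0)).map fun l => l :: w) := by
  rw [horadamRow, List.append_assoc]
  refine ((zigzag_perm_flatMap _ _ _).trans ?_).append_left D
  simp only [horadamTail_eq_cons b h ha, List.map_cons]
  exact (List.map_append_flatMap_perm L _ _).symm

theorem mem_row_iff {K : List (List ℕ)} (hL : IsHamiltonianList a b m L)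
    (hK : IsHamiltonianList a b (m + 1) K) (h v : List ℕ) :
    (v ∈ K ++ L.flatMap fun w =>
      (List.range' a (if h.getLast? = some 0 then b else 0)).map fun l => l :: w) ↔
    (IsHoradamString a b v ∨ (h.getLast? = some 0 ∧ ∃ l v', v = l :: v' ∧ a ≤ l ∧ l < a + b ∧
        IsHoradamString a b v')) ∧ v.length = m + 1 := by
  simp only [List.mem_append, List.mem_flatMap, List.mem_map, mem_range'_extra_iff, hK.mem_iff,
    hL.mem_iff]
  constructor
  · rintro (⟨hv, hlen⟩ | ⟨w, ⟨hw, hlen⟩, l, ⟨h0, hal, hlb⟩, rfl⟩)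
    · exact ⟨.inl hv, hlen⟩
    · exact ⟨.inr ⟨h0, l, w, rfl, hal, hlb, hw⟩, by simp [hlen]⟩
  · rintro ⟨hv | ⟨h0, l, w, rfl, hal, hlb, hw⟩, hlen⟩
    · exact .inl ⟨hv, hlen⟩
    · exact .inr ⟨w, ⟨hw, by simpa using hlen⟩, l, ⟨h0, hal, hlb⟩, rfl⟩

theorem nodup_row {K : List (List ℕ)} (ha : 1 ≤ a) (hL : IsHamiltonianList a b m L)
    (hK : IsHamiltonianList a b (m + 1) K) (h : List ℕ) :
    (K ++ L.flatMap fun w =>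
      (List.range' a (if h.getLast? = some 0 then b else 0)).map fun l => l :: w).Nodup := by
  rw [List.nodup_append, List.nodup_flatMap]
  refine ⟨hK.nodup, ⟨fun w _ => List.Nodup.map (fun l k h => by simpa using h) List.nodup_range',
    hL.nodup.imp fun {v w} h => ?_⟩, ?_⟩
  · simp only [Function.onFun, List.disjoint_left, List.mem_map]
    grind
  · simp only [List.mem_flatMap, List.mem_map, mem_range'_extra_iff]
    rintro _ hv _ ⟨w, -, l, ⟨-, hal, -⟩, rfl⟩ rfl
    have := ((hK.mem_iff _).1 hv).1.lt_of_cons ha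
    omega

end Row

/-! ### The Hamiltonian cycle -/

theorem IsHamiltonianList.exists_cycle {a b r m : ℕ} {c : List ℕ} {D L H : List (List ℕ)}
    (ha : 1 ≤ a) (hH : IsHamiltonianList a b r H) (hHe : Even H.length)
    (hL : IsHamiltonianList a b m L) (hLe : Even L.length)
    (hK : IsHamiltonianList a b (m + 1) (c :: (D ++ L.map (List.cons (a - 1))))) :
    ∃ M, IsHamiltonianList a b (r + (m + 1)) M ∧ 3 ≤ M.length ∧
      ∀ x ∈ M.getLast?, ∀ y ∈ M.head?, LetterAdj x y := by
  have hLne := hL.ne_nil ha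
  set row : List ℕ → List (List ℕ) := fun h => (horadamRow a b D L h).map (h ++ ·) with hrow
  obtain ⟨d, E, hdE⟩ : ∃ d E, D ++ L.map (List.cons (a - 1)) = d :: E :=
    List.exists_cons_of_ne_nil (by simp [hLne])
  have hhead : ∀ h, (row h).head? = some (h ++ d) := fun h => by
    simp [hrow, head?_horadamRow ha hLne, hdE]
  have hrne : ∀ h, row h ≠ [] := fun h e => by simpa [e] using hhead h
  have hcd : LetterAdj c d := by
    have := hK.isChain
    rw [hdE] at this
    exact (List.isChain_cons_cons.1 this).1
  have hrows : (zigzag row true H).IsChain LetterAdj := by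
    refine isChain_zigzag LetterAdj.symm hrne (fun h _ => ?_) (hH.isChain.imp fun h h' hh => ⟨?_, ?_⟩)
      true
    · exact List.isChain_map_of_isChain _ (fun v w hvw => hvw.append_left h)
        (isChain_horadamRow ha hLne hL.isChain hK.isChain.tail h)
    · simpa [hhead] using hh.append_right d
    · simp only [hrow, List.getLast?_map, getLast?_horadamRow ha hLe]
      rcases (D ++ L.map (List.cons (a - 1))).getLast? with - | w
      · simp
      · simpa using hh.append_right w
  have hperm : (zigzag row true H ++ (H.map (· ++ c)).reverse).Perm (H.flatMap fun h =>
      ((c :: (D ++ L.map (List.cons (a - 1)))) ++ L.flatMap fun w =>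
        (List.range' a (if h.getLast? = some 0 then b else 0)).map fun l => l :: w).map (h ++ ·)) := by
    refine ((zigzag_perm_flatMap _ _ _).append (List.reverse_perm _)).trans <|
      List.perm_append_comm.trans <| (List.map_append_flatMap_perm H _ _).trans <|
      List.Perm.flatMap_left _ fun h _ => ?_
    simpa [hrow] using ((horadamRow_perm (D := D) (L := L) (b := b) ha h).map (h ++ ·))
  obtain ⟨h₀, t, ht⟩ := List.exists_cons_of_ne_nil (hH.ne_nil ha)
  have hfirst : (zigzag row true H ++ (H.map (· ++ c)).reverse).head? = some (h₀ ++ d) := by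
    rw [ht, List.head?_append, head?_zigzag_cons (hrne _), hhead]
    rfl
  refine ⟨zigzag row true H ++ (H.map (· ++ c)).reverse, ⟨?_, ?_, fun w => ?_⟩, ?_, ?_⟩
  · refine List.isChain_append.2 ⟨hrows, List.isChain_reverse.2 (List.isChain_map_of_isChain _
      (fun x y hxy => (hxy.append_right c).symm) hH.isChain), ?_⟩
    -- With evenly many rows the snake stops at suffix `d`, the neighbour of `c`, in the last row.
    rw [getLast?_zigzag_of_even hrne hHe, List.head?_reverse, List.getLast?_map]
    rcases H.getLast? with - | h
    · simp
    · simpa [hhead] using hcd.symm.append_left h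
  · rw [hperm.nodup_iff, List.nodup_flatMap]
    refine ⟨fun h _ => (nodup_row ha hL hK h).map fun v w e => by simpa using e,
      hH.nodup.imp_of_mem fun {h h'} hh hh' hne => ?_⟩
    simp only [Function.onFun, List.disjoint_left, List.mem_map]
    rintro _ ⟨v, -, rfl⟩ ⟨w, -, e⟩
    exact hne (List.append_inj_left e
      (((hH.mem_iff _).1 hh').2.trans ((hH.mem_iff _).1 hh).2.symm)).symm
  · rw [hperm.mem_iff]
    simp only [List.mem_flatMap, List.mem_map, mem_row_iff hL hK, hH.mem_iff]
    constructor
    · rintro ⟨h, ⟨hh, hr⟩, v, ⟨hv | ⟨h0, l, v, rfl, hal, hlb, hv⟩, hlen⟩, rfl⟩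
      · exact ⟨hh.append hv, by simp [hr, hlen]⟩
      · exact ⟨hh.append_cons ha h0 hal hlb hv, by simpa [hr] using hlen⟩
    · rintro ⟨hw, hlen⟩
      obtain ⟨u, v, rfl, hu, hu', hv⟩ := hw.exists_append ha (r := r) (by omega)
      exact ⟨u, ⟨hu', hu⟩, v, ⟨hv, by simpa [hu] using hlen⟩, rfl⟩
  · have hz : H.length ≤ (zigzag row true H).length := by
      rw [(zigzag_perm_flatMap row true H).length_eq, List.length_flatMap]
      rw [show H.length = (H.map fun _ => 1).sum by simp]
      exact List.sum_le_sum (l := H) (f := fun _ => 1) fun h _ =>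
        List.length_pos_iff.2 (hrne h)
    have h2 : 2 ≤ H.length := by
      have : 0 < H.length := by simp [ht]
      obtain ⟨k, hk⟩ := hHe
      omega
    simp only [List.length_append, List.length_reverse, List.length_map]
    omega
  · rw [hfirst, List.getLast?_append, List.getLast?_reverse, ht]
    simpa using hcd.append_left h₀

theorem exists_isHamiltonianList_cycle {a b r m : ℕ} (ha : 1 ≤ a)
    (hr : Even (horadamNumber a b r)) (hm : Even (horadamNumber a b m))
    (hlt : horadamNumber a b m ≠ horadamNumber a b (m + 1)) :
    ∃ M, IsHamiltonianList a b (r + (m + 1)) M ∧ 3 ≤ M.length ∧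
      ∀ x ∈ M.getLast?, ∀ y ∈ M.head?, LetterAdj x y := by
  obtain ⟨-, H, hH, -, hHlen, -⟩ := exists_isHamiltonianList_pair b r ha
  obtain ⟨D, L, hL, hK, hLlen, hKlen⟩ := exists_isHamiltonianList_pair b m ha
  -- Differing counts force `D` to be nonempty, which supplies the return column `c`.
  rcases D with - | ⟨c, D⟩
  · rw [List.nil_append, List.length_map, hLlen] at hKlen
    exact absurd hKlen hlt
  · exact hH.exists_cycle ha (hHlen ▸ hr) hL (hLlen ▸ hm) hK

/-! ### Transfer to the graph and choice of the splitting -/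

/-- The vertices of the Horadam cube in the order of a list of Horadam strings. -/
def IsHamiltonianList.vertices {a b n : ℕ} {M : List (List ℕ)} (h : IsHamiltonianList a b n M) :
    List (HoradamVertex a b n) :=
  M.attachWith _ fun w hw => (h.mem_iff w).1 hw

section Vertices

variable {a b n : ℕ} {M : List (List ℕ)} (h : IsHamiltonianList a b n M)

theorem IsHamiltonianList.map_val_vertices : h.vertices.map Subtype.val = M :=
  List.attachWith_map_subtype_val _

theorem IsHamiltonianList.isChain_vertices : h.vertices.IsChain (horadamCube a b n).Adj := by
  have := h.isChain
  rw [← h.map_val_vertices] at this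
  exact List.isChain_of_isChain_map Subtype.val (fun _ _ hvw => hvw) this

theorem IsHamiltonianList.nodup_vertices : h.vertices.Nodup := by
  have := h.nodup
  rw [← h.map_val_vertices] at this
  exact this.of_map _

theorem IsHamiltonianList.mem_vertices (v : HoradamVertex a b n) : v ∈ h.vertices := by
  simp [IsHamiltonianList.vertices, h.mem_iff, v.2]

theorem IsHamiltonianList.adj_of_letterAdj
    (hM : ∀ x ∈ M.getLast?, ∀ y ∈ M.head?, LetterAdj x y) :
    ∀ x ∈ h.vertices.getLast?, ∀ y ∈ h.vertices.head?, (horadamCube a b n).Adj x y := by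
  intro x hx y hy
  refine hM x.1 ?_ y.1 ?_
  · rw [← h.map_val_vertices, List.getLast?_map, Option.mem_def.1 hx]; rfl
  · rw [← h.map_val_vertices, List.head?_map, Option.mem_def.1 hy]; rfl

end Vertices

theorem card_horadamVertex {a : ℕ} (b n : ℕ) (ha : 1 ≤ a) :
    Nat.card (HoradamVertex a b n) = horadamNumber a b n := by
  obtain ⟨-, L, hL, -, hlen, -⟩ := exists_isHamiltonianList_pair b n ha
  rw [hL.card_eq_length, hlen]

theorem horadamNumber_pos {a : ℕ} (b n : ℕ) (ha : 1 ≤ a) : 0 < horadamNumber a b n := by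
  obtain ⟨-, L, hL, -, hlen, -⟩ := exists_isHamiltonianList_pair b n ha
  rw [← hlen]
  exact List.length_pos_iff.2 (hL.ne_nil ha)

theorem exists_isHamiltonianList_cycle_of_even {a b n : ℕ} (ha : 1 ≤ a) (hn : 2 < n)
    (heven : Even (horadamNumber a b n)) :
    ∃ M, IsHamiltonianList a b n M ∧ 3 ≤ M.length ∧
      ∀ x ∈ M.getLast?, ∀ y ∈ M.head?, LetterAdj x y := by
  by_cases hae : Even a
  -- Prefixes have length 1, with even count `a`; the other count is at `n - 2`, of the same parity
  -- as `n` and at least 1.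
  · obtain ⟨m, rfl⟩ : ∃ m, n = 1 + (m + 1 + 1) := ⟨n - 3, by omega⟩
    refine exists_isHamiltonianList_cycle ha (by simpa [horadamNumber]) ?_ ?_
    · rw [even_horadamNumber_iff] at heven ⊢
      simp only [Nat.odd_iff, Nat.even_iff] at *
      omega
    · rw [horadamNumber]
      have ha2 : 2 ≤ a := by obtain ⟨k, rfl⟩ := hae; omega
      have := horadamNumber_pos b (m + 1) ha
      nlinarith [Nat.zero_le (b * horadamNumber a b m)]
  · have h3 := heven
    rw [even_horadamNumber_iff] at h3
    simp only [hae, Nat.not_even_iff_odd.1 hae, false_and, false_or, true_and] at h3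
    obtain ⟨hb, k, hk, rfl⟩ := h3
    -- Here `n > 2` excludes `k = 1`. The lengths 2 and `n - 3` are both 2 modulo 3, so both counts
    -- are even, while the count at `n - 2` is odd.
    obtain ⟨j, rfl⟩ : ∃ j, k = j + 2 := ⟨k - 2, by omega⟩
    have hao := Nat.not_even_iff_odd.1 hae
    have hm : Even (horadamNumber a b (3 * j + 2)) :=
      (even_horadamNumber_iff _ _ _).2 (.inr (.inr ⟨hao, hb, j + 1, by omega, by omega⟩))
    have hm' : ¬ Even (horadamNumber a b (3 * j + 2 + 1)) := by
      rw [even_horadamNumber_iff]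
      rintro (h | h | ⟨-, -, i, hi, hi'⟩)
      · exact hae h.1
      · exact hae h.1
      · omega
    rw [show 3 * (j + 2) - 1 = 2 + (3 * j + 2 + 1) by omega]
    refine exists_isHamiltonianList_cycle ha ?_ hm fun e => hm' (e ▸ hm)
    exact (even_horadamNumber_iff _ _ _).2 (.inr (.inr ⟨hao, hb, 1, by omega, by omega⟩))

theorem mainTheorem11 (a b n : ℕ) (ha : 1 ≤ a) :
    (∃ (u v : HoradamVertex a b n) (p : (horadamCube a b n).Walk u v), p.IsHamiltonian) ∧
    (2 < n → Even (Nat.card (HoradamVertex a b n)) →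
      ∃ (v : HoradamVertex a b n) (p : (horadamCube a b n).Walk v v), p.IsHamiltonianCycle) ∧
    (Even (Nat.card (HoradamVertex a b n)) ↔
      (Even a ∧ Even b ∧ 1 ≤ n) ∨ (Even a ∧ Odd b ∧ Odd n) ∨
        (Odd a ∧ Odd b ∧ ∃ k : ℕ, 1 ≤ k ∧ n = 3 * k - 1)) := by
  rw [card_horadamVertex b n ha]
  refine ⟨?_, fun hn heven => ?_, even_horadamNumber_iff a b n⟩
  · obtain ⟨-, L, hL, -⟩ := exists_isHamiltonianList_pair b n ha
    refine SimpleGraph.exists_walk_isHamiltonian_of_list (l := hL.vertices) ?_ hL.isChain_vertices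
      hL.nodup_vertices hL.mem_vertices
    intro h
    exact hL.ne_nil ha (by rw [← hL.map_val_vertices, h, List.map_nil])
  · obtain ⟨M, hM, hlen, hclose⟩ := exists_isHamiltonianList_cycle_of_even ha hn heven
    exact SimpleGraph.exists_walk_isHamiltonianCycle_of_list
      (by rwa [← hM.map_val_vertices, List.length_map] at hlen) hM.isChain_vertices
      (hM.adj_of_letterAdj hclose) hM.nodup_vertices hM.mem_vertices
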